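/- **Definitions.** Let $X$ be a set. A *reproducing kernel* on a set $U$ is a symmetric function $K:U\times U\to\mathbb R$ with $\sum_{i,j=1}^m\alpha_i\alpha_jK(x_i,x_j)\ge 0$ for all $m$, $x_i\in U$, $\alpha_i\in\mathbb R$; $\mathscr H(K)$ denotes its reproducing kernel Hilbert space, a Hilbert space of functions on $U$ generated by the functions $k_x=K(x,\cdot)$, and $K_A=K|_{A\times A}$ for $A\subset U$. Let $n\ge1$. A set $\Omega\subset X\times X$ is an *$n$-serrated domain*, represented by subsets $X_1,\dots,X_n$ of $X$, if $X=\bigcup_jX_j$, $\Omega=\bigcup_j(X_j\times X_j)$ and $X_i\cap X_k\subset X_i\cap X_j$ for $1\le i<j<k\le n$. A function $K_\Omega:\Omega\to\mathbb R$ is a *partially reproducing kernel* if $K_A=K_\Omega|_{A\times A}$ is a reproducing kernel for every $A\subset X$ with $A\times A\subset\Omega$; for such $A$ and $x\in A$ put $k_{x,A}=K_\Omega(x,\cdot)|_A\in\mathscr H(K_A)$. If $(A\cup B)\times(A\cup B)\subset\Omega$, let $\Phi_{B,A}:\mathscr H(K_A)\to\mathscr H(K_B)$ be the contraction that is the unique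 bounded linear map sending $k_{x,A}$ to $K_\Omega(x,\cdot)|_B$ for every $x\in A$. A *completion* of $K_\Omega$ is a reproducing kernel $K$ on $X$ with $K|_\Omega=K_\Omega$. Points $x,y\in X\setminus S$ are *separated* by $S\subset X$ if every path $x=z_0,z_1,\dots,z_{m+1}=y$ with $(z_k,z_{k+1})\in\Omega$ for $0\le k\le m$ has $z_k\in S$ for some $1\le k\le m$. A completion $K_\star$ is *canonical* if $K_\star(x,y)=\langle K_\star(x,\cdot)|_S,\,K_\star(y,\cdot)|_S\rangle_{\mathscr H((K_\star)_S)}$ whenever $S\subset X$ separates $x,y\in X$. **Theorem.** Let $K_\Omega$ be a partially reproducing kernel on an $n$-serrated domain $\Omega$ on $X$ represented by $X_1,\dots,X_n$. Then: 1. $K_\Omega$ has a unique canonical completion $K_\star$. 2. If $x\in X_i$ and $y\in X_j$ with $1\le i<j\le n$, then $$K_\star(x,y)=\big\langle[\Phi_{j,j-1}\cdots\Phi_{i+2,i+1}\Phi_{i+1,i}]\,k_{x,X_i},\;k_{y,X_j}\big\rangle_{\mathscr H(K_{X_j})},$$ where $\Phi_{p,q}=\Phi_{X_p,\,X_p\cap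 X_q}\,\Phi_{X_p\cap X_q,\,X_q}:\mathscr H(K_{X_q})\to\mathscr H(K_{X_p})$ for $|p-q|=1$. 3. For every $f\in\mathscr H(K_\star)$, $$\|f\|_\star^2=\sum_{j=1}^n\big\|f|_{X_j}\big\|^2-\sum_{j=1}^{n-1}\big\|f|_{X_j\cap X_{j+1}}\big\|^2,$$ where $\|\cdot\|_\star$ is the norm of $\mathscr H(K_\star)$ and $\|f|_U\|$ is the norm of $f|_U$ in $\mathscr H(K_U)$. -/

import Mathlib

noncomputable section

open Set
open scoped InnerProductSpace

namespace KernelCompletion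

/-! ### Reproducing kernels and their Hilbert spaces -/

/-- A real function of two variables that is symmetric and positive semidefinite. -/
def IsReproducingKernel {U : Type*} (K : U → U → ℝ) : Prop :=
  (∀ x y, K x y = K y x) ∧
    ∀ (n : ℕ) (α : Fin n → ℝ) (x : Fin n → U), 0 ≤ ∑ i, ∑ j, α i * α j * K (x i) (x j)

/-- A reproducing kernel on `U`. -/
@[ext]
structure ReproducingKernel (U : Type*) where
  toFun : U → U → ℝ
  isReproducingKernel : IsReproducingKernel toFun

namespace ReproducingKernel

variable {U V : Type*}

instance : CoeFun (ReproducingKernel U) (fun _ => U → U → ℝ) := ⟨ReproducingKernel.toFun⟩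

/-- The kernel with each scalar `K x y` regarded as multiplication by `K x y` on `ℝ`. -/
def mat (K : ReproducingKernel U) : Matrix U U (ℝ →L[ℝ] ℝ) :=
  Matrix.of fun x y => K x y • (1 : ℝ →L[ℝ] ℝ)

theorem mat_posSemidef (K : ReproducingKernel U) : K.mat.PosSemidef := by
  have key := (RKHS.posSemidef_tfae (K := K.mat)).out 0 2 rfl rfl
  refine key.mpr ⟨?_, fun v => ?_⟩
  · ext x y
    simp [mat, Matrix.conjTranspose_apply, K.isReproducingKernel.1 y x]
  · let e := v.support.equivFin.symm
    have h := K.isReproducingKernel.2 v.support.card (fun i => v (e i)) (fun i => (e i : U))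
    rw [Equiv.sum_comp e (fun a => ∑ j, v a * v (e j) * K (a : U) (e j))] at h
    simp_rw [fun a : v.support =>
      Equiv.sum_comp e (fun b => v a * v b * K (a : U) (b : U))] at h
    rw [Finset.sum_coe_sort v.support
      (fun a => ∑ b : v.support, v a * v b * K (a : U) (b : U))] at h
    simp_rw [fun a : U => Finset.sum_coe_sort v.support (fun b => v a * v b * K a b)] at h
    convert h using 1
    simp only [Finsupp.sum, mat, Matrix.of_apply, RCLike.re_to_real]
    refine Finset.sum_congr rfl fun a _ => Finset.sum_congr rfl fun b _ => ?_
    simp [K.isReproducingKernel.1 b a]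
    ring

instance (K : ReproducingKernel U) : Fact K.mat.PosSemidef := ⟨K.mat_posSemidef⟩

/-- The reproducing kernel Hilbert space of `K`. -/
def H (K : ReproducingKernel U) : Type _ := RKHS.OfKernel K.mat

instance (K : ReproducingKernel U) : NormedAddCommGroup K.H :=
  inferInstanceAs (NormedAddCommGroup (RKHS.OfKernel K.mat))

instance (K : ReproducingKernel U) : InnerProductSpace ℝ K.H :=
  inferInstanceAs (InnerProductSpace ℝ (RKHS.OfKernel K.mat))

instance (K : ReproducingKernel U) : CompleteSpace K.H :=
  inferInstanceAs (CompleteSpace (RKHS.OfKernel K.mat))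

instance (K : ReproducingKernel U) : RKHS ℝ K.H U ℝ :=
  inferInstanceAs (RKHS ℝ (RKHS.OfKernel K.mat) U ℝ)

/-- The generator `k_x = K(x, ·)` as an element of `H(K)`. -/
def gen (K : ReproducingKernel U) (x : U) : K.H := RKHS.kerFun K.H x 1

@[simp]
theorem gen_apply (K : ReproducingKernel U) (x y : U) : K.gen x y = K x y := by
  have h : RKHS.kernel K.H = K.mat := RKHS.OfKernel.kernel_ofKernel (K := K.mat)
  rw [gen, RKHS.kerFun_apply, h]
  simp [mat, K.isReproducingKernel.1 y x]

theorem inner_gen (K : ReproducingKernel U) (f : K.H) (x : U) : ⟪f, K.gen x⟫_ℝ = f x := by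
  simp [gen]

theorem span_gen_dense (K : ReproducingKernel U) :
    (Submodule.span ℝ (range K.gen)).topologicalClosure = ⊤ := by
  rw [eq_top_iff, ← RKHS.kerFun_dense (𝕜 := ℝ) K.H]
  refine Submodule.topologicalClosure_mono (Submodule.span_le.mpr ?_)
  rintro _ ⟨x, v, rfl⟩
  have : RKHS.kerFun K.H x v = v • K.gen x := by
    rw [gen, ← map_smul, smul_eq_mul, mul_one]
  rw [this]
  exact Submodule.smul_mem _ _ (Submodule.subset_span ⟨x, rfl⟩)

/-- The linear map `a ↦ ∑ a_x k_x` from finitely supported coefficients to `H(K)`. -/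
def combo (K : ReproducingKernel U) : (U →₀ ℝ) →ₗ[ℝ] K.H := Finsupp.linearCombination ℝ K.gen

theorem combo_denseRange (K : ReproducingKernel U) : DenseRange K.combo := by
  have h := K.span_gen_dense
  rw [← Finsupp.range_linearCombination] at h
  have h2 := (Submodule.dense_iff_topologicalClosure_eq_top).mpr h
  rwa [LinearMap.coe_range] at h2

theorem combo_norm (L : ReproducingKernel U) (M : ReproducingKernel V) (φ : U → V)
    (h : ∀ x y, L x y = M (φ x) (φ y)) (a : U →₀ ℝ) :
    ‖M.combo (Finsupp.lmapDomain ℝ ℝ φ a)‖ = ‖L.combo a‖ := by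
  rw [← sq_eq_sq₀ (norm_nonneg _) (norm_nonneg _), ← real_inner_self_eq_norm_sq,
    ← real_inner_self_eq_norm_sq]
  have e : M.combo (Finsupp.lmapDomain ℝ ℝ φ a)
      = Finsupp.linearCombination ℝ (fun x => M.gen (φ x)) a := by
    rw [combo, Finsupp.lmapDomain_apply, Finsupp.linearCombination_mapDomain]
    rfl
  rw [e, combo, Finsupp.linearCombination_apply, Finsupp.linearCombination_apply]
  simp only [Finsupp.sum, inner_sum, sum_inner, inner_smul_left, inner_smul_right, inner_gen,
    gen_apply, h]

/-- For `L(x, y) = M(φ x, φ y)`, the continuous linear map `H(L) → H(M)` with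
`k_x ↦ k_{φ x}`. -/
def push (L : ReproducingKernel U) (M : ReproducingKernel V) (φ : U → V) : L.H →L[ℝ] M.H :=
  (M.combo ∘ₗ Finsupp.lmapDomain ℝ ℝ φ).extendOfNorm L.combo

theorem push_gen (L : ReproducingKernel U) (M : ReproducingKernel V) (φ : U → V)
    (h : ∀ x y, L x y = M (φ x) (φ y)) (x : U) : L.push M φ (L.gen x) = M.gen (φ x) := by
  have := LinearMap.extendOfNorm_eq (f := M.combo ∘ₗ Finsupp.lmapDomain ℝ ℝ φ) (e := L.combo)
    L.combo_denseRange ⟨1, fun a => by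
      rw [one_mul, LinearMap.comp_apply, combo_norm L M φ h]⟩ (Finsupp.single x 1)
  simpa [push, combo] using this

theorem push_norm_le (L : ReproducingKernel U) (M : ReproducingKernel V) (φ : U → V)
    (h : ∀ x y, L x y = M (φ x) (φ y)) : ‖L.push M φ‖ ≤ 1 :=
  LinearMap.opNorm_extendOfNorm_le (f := M.combo ∘ₗ Finsupp.lmapDomain ℝ ℝ φ) (e := L.combo)
    L.combo_denseRange zero_le_one fun a => by
      rw [one_mul, LinearMap.comp_apply, combo_norm L M φ h]

/-- For `L(x, y) = M(φ x, φ y)`, the continuous linear map `H(M) → H(L)`, `f ↦ f ∘ φ`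
(see `pull_apply`). It is the restriction map when `φ` is an inclusion. -/
def pull (L : ReproducingKernel U) (M : ReproducingKernel V) (φ : U → V) : M.H →L[ℝ] L.H :=
  ContinuousLinearMap.adjoint (L.push M φ)

theorem pull_apply (L : ReproducingKernel U) (M : ReproducingKernel V) (φ : U → V)
    (h : ∀ x y, L x y = M (φ x) (φ y)) (f : M.H) (x : U) : L.pull M φ f x = f (φ x) := by
  rw [← inner_gen, pull, ContinuousLinearMap.adjoint_inner_left, push_gen L M φ h, inner_gen]

/-- The subkernel `K_A`, for `A ⊆ U`. -/
def sub (K : ReproducingKernel U) (A : Set U) : ReproducingKernel A where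
  toFun x y := K x y
  isReproducingKernel := ⟨fun _ _ => K.isReproducingKernel.1 _ _,
    fun n α x => K.isReproducingKernel.2 n α (fun i => (x i : U))⟩

/-- The element `k_{x,A} = K(x, ·)|_A` of `H(K_A)`, for arbitrary `x ∈ U` and `A ⊆ U`. -/
def genOn (K : ReproducingKernel U) (x : U) (A : Set U) : (K.sub A).H :=
  (K.sub A).pull K Subtype.val (K.gen x)

theorem genOn_apply (K : ReproducingKernel U) (x : U) (A : Set U) (y : A) :
    K.genOn x A y = K x y := by
  rw [genOn, pull_apply (K.sub A) K Subtype.val (fun _ _ => rfl), gen_apply]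

end ReproducingKernel

/-! ### Domains, separation, partially reproducing kernels -/

variable {X : Type*}

/-- `z 0, …, z (n + 1)` is a path from `x` to `y` in the graph with edge set `Ω`. -/
def IsPath (Ω : Set (X × X)) (x y : X) (n : ℕ) (z : ℕ → X) : Prop :=
  z 0 = x ∧ z (n + 1) = y ∧ ∀ k ≤ n, (z k, z (k + 1)) ∈ Ω

/-- `x` and `y` are separated by `S` in `Ω`: they lie outside `S`, and every path between them
passes through `S`. (If there is no path, this holds for `S = ∅`.) -/
def Separates (Ω : Set (X × X)) (S : Set X) (x y : X) : Prop :=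
  x ∉ S ∧ y ∉ S ∧ ∀ n z, IsPath Ω x y n z → ∃ k, 1 ≤ k ∧ k ≤ n ∧ z k ∈ S

/-- `A` is a clique of `Ω`. -/
def IsClique (Ω : Set (X × X)) (A : Set X) : Prop := A ×ˢ A ⊆ Ω

theorem IsClique.mono {Ω : Set (X × X)} {A B : Set X} (hB : IsClique Ω B) (h : A ⊆ B) :
    IsClique Ω A := (Set.prod_mono h h).trans hB

theorem IsClique.mem {Ω : Set (X × X)} {A : Set X} (hA : IsClique Ω A) {x y : X} (hx : x ∈ A)
    (hy : y ∈ A) : (x, y) ∈ Ω := hA ⟨hx, hy⟩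

/-- A partially reproducing kernel on `Ω`: a function on `Ω` whose restriction to `A × A` is a
reproducing kernel for every clique `A`. -/
structure PartialKernel (Ω : Set (X × X)) where
  toFun : Ω → ℝ
  isReproducingKernel : ∀ (A : Set X) (hA : IsClique Ω A),
    IsReproducingKernel fun x y : A => toFun ⟨((x : X), (y : X)), hA.mem x.2 y.2⟩

/-- `S 0, …, S n` exhibit `Ω` as an `(n + 1)`-serrated domain on `X`. (Such an `Ω` is symmetric
and contains the diagonal.) -/
structure IsSerrated {n : ℕ} (Ω : Set (X × X)) (S : Fin (n + 1) → Set X) : Prop where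
  cover : ⋃ j, S j = univ
  inter_subset : ∀ i j k, i < j → j < k → S i ∩ S k ⊆ S i ∩ S j
  eq_iUnion : Ω = ⋃ j, S j ×ˢ S j

theorem IsSerrated.isClique {n : ℕ} {Ω : Set (X × X)} {S : Fin (n + 1) → Set X}
    (h : IsSerrated Ω S) (j : Fin (n + 1)) : IsClique Ω (S j) := by
  rw [IsClique, h.eq_iUnion]
  exact subset_iUnion (fun j => S j ×ˢ S j) j

namespace PartialKernel

variable {Ω : Set (X × X)}

/-- The kernel `K_A` on a clique `A`. -/
def sub (K : PartialKernel Ω) (A : Set X) (hA : IsClique Ω A) : ReproducingKernel A where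
  toFun x y := K.toFun ⟨((x : X), (y : X)), hA.mem x.2 y.2⟩
  isReproducingKernel := K.isReproducingKernel A hA

/-- The contraction `Φ_{B,A} : H(K_A) → H(K_B)` (for `A ∪ B` a clique), the unique bounded linear
map with `Φ_{B,A} k_{x,A} = k_{x,B}` for `x ∈ A`; see `contraction_gen` and `contraction_unique`.
It sends `k_{x,A}` to `k_{x,A ∪ B}` and then restricts to `B`. -/
def contraction (K : PartialKernel Ω) (B A : Set X) (h : IsClique Ω (A ∪ B)) :
    (K.sub A (h.mono subset_union_left)).H →L[ℝ] (K.sub B (h.mono subset_union_right)).H :=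
  (K.sub B (h.mono subset_union_right)).pull (K.sub (A ∪ B) h) (inclusion subset_union_right) ∘L
    (K.sub A (h.mono subset_union_left)).push (K.sub (A ∪ B) h) (inclusion subset_union_left)

theorem contraction_gen (K : PartialKernel Ω) (B A : Set X) (h : IsClique Ω (A ∪ B)) (x : A)
    (y : B) :
    K.contraction B A h ((K.sub A (h.mono subset_union_left)).gen x) y
      = K.toFun ⟨((x : X), (y : X)), h.mem (Or.inl x.2) (Or.inr y.2)⟩ := by
  rw [contraction, ContinuousLinearMap.comp_apply,
    ReproducingKernel.push_gen (K.sub A _) (K.sub (A ∪ B) h) (inclusion subset_union_left)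
      (fun _ _ => rfl),
    ReproducingKernel.pull_apply (K.sub B _) (K.sub (A ∪ B) h) (inclusion subset_union_right)
      (fun _ _ => rfl), ReproducingKernel.gen_apply]
  rfl

theorem contraction_norm_le (K : PartialKernel Ω) (B A : Set X) (h : IsClique Ω (A ∪ B)) :
    ‖K.contraction B A h‖ ≤ 1 := by
  have h1 := ReproducingKernel.push_norm_le (K.sub B (h.mono subset_union_right))
    (K.sub (A ∪ B) h) (inclusion subset_union_right) (fun _ _ => rfl)
  rw [← ContinuousLinearMap.adjoint.norm_map] at h1
  refine (ContinuousLinearMap.opNorm_comp_le _ _).trans (mul_le_one₀ h1 (norm_nonneg _) ?_)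
  exact ReproducingKernel.push_norm_le _ (K.sub (A ∪ B) h) (inclusion subset_union_left)
    (fun _ _ => rfl)

theorem contraction_unique (K : PartialKernel Ω) (B A : Set X) (h : IsClique Ω (A ∪ B))
    (T : (K.sub A (h.mono subset_union_left)).H →L[ℝ] (K.sub B (h.mono subset_union_right)).H)
    (hT : ∀ (x : A) (y : B), T ((K.sub A (h.mono subset_union_left)).gen x) y
      = K.toFun ⟨((x : X), (y : X)), h.mem (Or.inl x.2) (Or.inr y.2)⟩) :
    T = K.contraction B A h := by
  refine ContinuousLinearMap.ext_on
    (Submodule.dense_iff_topologicalClosure_eq_top.mpr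
      (K.sub A (h.mono subset_union_left)).span_gen_dense) ?_
  rintro _ ⟨x, rfl⟩
  refine RKHS.ext fun y => ?_
  rw [hT, contraction_gen]

/-- `Φ_{B, B ∩ A} Φ_{B ∩ A, A} : H(K_A) → H(K_B)` for cliques `A` and `B`. -/
def link (K : PartialKernel Ω) (B A : Set X) (hB : IsClique Ω B) (hA : IsClique Ω A) :
    (K.sub A hA).H →L[ℝ] (K.sub B hB).H :=
  K.contraction B (B ∩ A) (hB.mono (union_subset inter_subset_left subset_rfl)) ∘L
    K.contraction (B ∩ A) A (hA.mono (union_subset subset_rfl inter_subset_right))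

/-- The product `Φ_{j,j-1} ⋯ Φ_{i+2,i+1} Φ_{i+1,i} : H(K_{S i}) → H(K_{S j})` for `i ≤ j`, where
`Φ_{p,q}` is the `link` from `S q` to `S p`. The empty product is the identity. -/
def linkProd (K : PartialKernel Ω) {n : ℕ} (S : Fin (n + 1) → Set X)
    (hS : ∀ j, IsClique Ω (S j)) (i : Fin (n + 1)) {j : ℕ} (hij : (i : ℕ) ≤ j) :
    ∀ hj : j < n + 1, (K.sub (S i) (hS i)).H →L[ℝ] (K.sub (S ⟨j, hj⟩) (hS ⟨j, hj⟩)).H :=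
  Nat.leRec (motive := fun j _ => ∀ hj : j < n + 1,
      (K.sub (S i) (hS i)).H →L[ℝ] (K.sub (S ⟨j, hj⟩) (hS ⟨j, hj⟩)).H)
    (fun _ => ContinuousLinearMap.id ℝ _)
    (fun j _ P hj => K.link (S ⟨j + 1, hj⟩) (S ⟨j, j.lt_succ_self.trans hj⟩) (hS _) (hS _) ∘L
      P (j.lt_succ_self.trans hj))
    hij

theorem linkProd_self (K : PartialKernel Ω) {n : ℕ} (S : Fin (n + 1) → Set X)
    (hS : ∀ j, IsClique Ω (S j)) (i : Fin (n + 1)) :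
    K.linkProd S hS i le_rfl i.2 = ContinuousLinearMap.id ℝ _ := by
  rw [linkProd, Nat.leRec_self]

theorem linkProd_succ (K : PartialKernel Ω) {n : ℕ} (S : Fin (n + 1) → Set X)
    (hS : ∀ j, IsClique Ω (S j)) (i : Fin (n + 1)) {j : ℕ} (hij : (i : ℕ) ≤ j)
    (hj : j + 1 < n + 1) :
    K.linkProd S hS i (hij.trans j.le_succ) hj =
      K.link (S ⟨j + 1, hj⟩) (S ⟨j, j.lt_succ_self.trans hj⟩) (hS _) (hS _) ∘L
        K.linkProd S hS i hij (j.lt_succ_self.trans hj) := by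
  rw [linkProd, Nat.leRec_succ _ _ hij]
  rfl

/-! ### Completions -/

/-- The reproducing kernel `L` on `X` restricts to `K` on `Ω`. -/
def IsCompletion (K : PartialKernel Ω) (L : ReproducingKernel X) : Prop :=
  ∀ p : Ω, L p.1.1 p.1.2 = K.toFun p

/-- `L` is a completion and `L(x, y) = ⟨k_{x,S}, k_{y,S}⟩` in `H(L_S)` whenever `S` separates `x`
and `y` in `Ω`. -/
def IsCanonicalCompletion (K : PartialKernel Ω) (L : ReproducingKernel X) : Prop :=
  K.IsCompletion L ∧
    ∀ (S : Set X) (x y : X), Separates Ω S x y → L x y = ⟪L.genOn x S, L.genOn y S⟫_ℝ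

/-- The restriction `f ↦ f|_A`, from `H(L)` to `H(K_A)`, for a completion `L` of `K` and a
clique `A`; see `restrict_apply`. -/
def restrict (K : PartialKernel Ω) (L : ReproducingKernel X) (A : Set X) (hA : IsClique Ω A) :
    L.H →L[ℝ] (K.sub A hA).H :=
  (K.sub A hA).pull L Subtype.val

theorem restrict_apply (K : PartialKernel Ω) (L : ReproducingKernel X) (hL : K.IsCompletion L)
    (A : Set X) (hA : IsClique Ω A) (f : L.H) (x : A) : K.restrict L A hA f x = f x :=
  ReproducingKernel.pull_apply (K.sub A hA) L Subtype.val
    (fun a b => (hL ⟨((a : X), (b : X)), hA.mem a.2 b.2⟩).symm) f x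

end PartialKernel

end KernelCompletion

end

/-! Fix a completion `L` and let `P_A` be the orthogonal projection of `L.H` onto the closed span of
the `k_x`, `x ∈ A`. Restriction to `A` is the adjoint of an isometric embedding with that range, so
`⟪f|_A, g|_A⟫ = ⟪P_A f, g⟫`. The canonical condition becomes `L x y = ⟪P_S k_x, k_y⟫`: orthogonality
relative to the span of `S`.

The sets containing a given point have consecutive indices, so `C_j = S_j ∩ S_{j+1}` separates
earlier from later points. A canonical `L` is therefore Markov along the chain
(`IsCanonicalCompletion.isMarkov`). Conversely, every separating set contains some `C_j`, for
otherwise a path can be drawn through points of the `C_j` that it misses; and enlarging a separator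
preserves relative orthogonality (`CondOrth.enlarge`). So Markov completions are canonical.

Existence: adjoin the sets one at a time, gluing orthogonally over `C_j` (`exists_glue`). Product
formula: each link replaces `k_x` by its projection onto the span of `C_j`, which by the Markov
property does not change its values on `S_{j+1}`. The formula involves only `K`, hence uniqueness.
Norm identity: relative orthogonality gives `P_{A ∪ B} = P_A + P_B - P_C`, applied once for each set
adjoined. -/

noncomputable section

open Set
open scoped InnerProductSpace

namespace KernelCompletion

/-! ### Feature kernels, closed spans and orthogonal projections. -/

namespace ReproducingKernel

variable {U V X : Type*}

/-- The kernel `⟪φ x, φ y⟫` of a map `φ` into an inner product space. -/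
def ofFeature {E : Type*} [NormedAddCommGroup E] [InnerProductSpace ℝ E] (φ : U → E) :
    ReproducingKernel U where
  toFun x y := ⟪φ x, φ y⟫_ℝ
  isReproducingKernel := by
    refine ⟨fun x y => real_inner_comm _ _, fun n α x => ?_⟩
    have h : ∑ i, ∑ j, α i * α j * ⟪φ (x i), φ (x j)⟫_ℝ
        = ⟪∑ i, α i • φ (x i), ∑ i, α i • φ (x i)⟫_ℝ := by
      rw [sum_inner]
      refine Finset.sum_congr rfl fun i _ => ?_
      rw [inner_sum]
      refine Finset.sum_congr rfl fun j _ => ?_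
      rw [real_inner_smul_left, real_inner_smul_right, mul_assoc]
    rw [h]
    exact real_inner_self_nonneg

theorem ofFeature_apply {E : Type*} [NormedAddCommGroup E] [InnerProductSpace ℝ E] (φ : U → E)
    (x y : U) : ofFeature φ x y = ⟪φ x, φ y⟫_ℝ := rfl

theorem inner_gen_gen (L : ReproducingKernel U) (x y : U) : ⟪L.gen x, L.gen y⟫_ℝ = L x y := by
  rw [inner_gen, gen_apply]

/-- The closed linear span of the generators `k_x` with `x ∈ A`. -/
def closedSpan (L : ReproducingKernel X) (A : Set X) : Submodule ℝ L.H :=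
  (Submodule.span ℝ (L.gen '' A)).topologicalClosure

theorem isClosed_closedSpan (L : ReproducingKernel X) (A : Set X) :
    IsClosed (L.closedSpan A : Set L.H) :=
  Submodule.isClosed_topologicalClosure _

instance (L : ReproducingKernel X) (A : Set X) : CompleteSpace (L.closedSpan A) :=
  (L.isClosed_closedSpan A).completeSpace_coe

theorem gen_mem_closedSpan (L : ReproducingKernel X) {A : Set X} {x : X} (hx : x ∈ A) :
    L.gen x ∈ L.closedSpan A :=
  Submodule.le_topologicalClosure _ (Submodule.subset_span ⟨x, hx, rfl⟩)

theorem closedSpan_le (L : ReproducingKernel X) {A : Set X} {M : Submodule ℝ L.H}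
    (hM : IsClosed (M : Set L.H)) (h : ∀ x ∈ A, L.gen x ∈ M) : L.closedSpan A ≤ M := by
  refine Submodule.topologicalClosure_minimal _ (Submodule.span_le.mpr ?_) hM
  rintro _ ⟨x, hx, rfl⟩
  exact h x hx

theorem closedSpan_mono (L : ReproducingKernel X) {A B : Set X} (h : A ⊆ B) :
    L.closedSpan A ≤ L.closedSpan B :=
  L.closedSpan_le (L.isClosed_closedSpan B) fun _ hx => L.gen_mem_closedSpan (h hx)

/-- Two continuous linear functionals that agree on the generators agree on the closed span. -/
theorem eqOn_closedSpan (L : ReproducingKernel X) {A : Set X} (u v : L.H →L[ℝ] ℝ)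
    (h : ∀ x ∈ A, u (L.gen x) = v (L.gen x)) {f : L.H} (hf : f ∈ L.closedSpan A) : u f = v f := by
  have hle : L.closedSpan A ≤ LinearMap.eqLocus u.toLinearMap v.toLinearMap :=
    L.closedSpan_le (isClosed_eq u.continuous v.continuous) h
  exact hle hf

/-- The orthogonal projection onto the closed span of the generators `k_x` with `x ∈ A`. -/
def proj (L : ReproducingKernel X) (A : Set X) : L.H →L[ℝ] L.H := (L.closedSpan A).starProjection

theorem proj_mem (L : ReproducingKernel X) (A : Set X) (f : L.H) : L.proj A f ∈ L.closedSpan A :=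
  Submodule.starProjection_apply_mem _ f

theorem proj_eq_self (L : ReproducingKernel X) {A : Set X} {f : L.H} (h : f ∈ L.closedSpan A) :
    L.proj A f = f :=
  Submodule.starProjection_eq_self_iff.mpr h

theorem proj_gen (L : ReproducingKernel X) {A : Set X} {x : X} (h : x ∈ A) :
    L.proj A (L.gen x) = L.gen x :=
  L.proj_eq_self (L.gen_mem_closedSpan h)

theorem inner_proj_left (L : ReproducingKernel X) (A : Set X) (f g : L.H) :
    ⟪L.proj A f, g⟫_ℝ = ⟪f, L.proj A g⟫_ℝ :=
  Submodule.inner_starProjection_left_eq_right _ f g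

theorem proj_proj_of_subset (L : ReproducingKernel X) {A B : Set X} (h : A ⊆ B) (f : L.H) :
    L.proj B (L.proj A f) = L.proj A f :=
  L.proj_eq_self (L.closedSpan_mono h (L.proj_mem A f))

theorem proj_apply_of_mem (L : ReproducingKernel X) {A : Set X} (f : L.H) {x : X} (hx : x ∈ A) :
    L.proj A f x = f x := by
  rw [← inner_gen, inner_proj_left, L.proj_gen hx, inner_gen]

theorem norm_proj_sq (L : ReproducingKernel X) (A : Set X) (f : L.H) :
    ‖L.proj A f‖ ^ 2 = ⟪L.proj A f, f⟫_ℝ := by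
  rw [← real_inner_self_eq_norm_sq, ← inner_proj_left, L.proj_eq_self (L.proj_mem A f)]

/-- The projection of `f` onto the closed span is characterised by its values on `A`. -/
theorem eq_proj (L : ReproducingKernel X) {A : Set X} {f g : L.H} (hg : g ∈ L.closedSpan A)
    (h : ∀ x ∈ A, g x = f x) : L.proj A f = g := by
  have h2 : ∀ w ∈ L.closedSpan A, ⟪f - g, w⟫_ℝ = 0 := fun w hw => by
    have := L.eqOn_closedSpan (innerSL ℝ f) (innerSL ℝ g) (fun x hx => by
      simp [inner_gen, h x hx]) hw
    rw [inner_sub_left, sub_eq_zero]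
    exact this
  exact Submodule.eq_starProjection_of_mem_of_inner_eq_zero hg h2

theorem proj_univ (L : ReproducingKernel X) (f : L.H) : L.proj univ f = f := by
  refine L.proj_eq_self ?_
  rw [closedSpan, image_univ, L.span_gen_dense]
  trivial

/-! ### Restriction as a projection -/

theorem pull_gen (N : ReproducingKernel U) (M : ReproducingKernel V) (φ : U → V)
    (h : ∀ x y, N x y = M (φ x) (φ y)) (x : U) : N.pull M φ (M.gen (φ x)) = N.gen x :=
  RKHS.ext fun y => by rw [pull_apply N M φ h, gen_apply, gen_apply, h]

theorem inner_push_left (N : ReproducingKernel U) (M : ReproducingKernel V) (φ : U → V)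
    (u : N.H) (f : M.H) : ⟪N.push M φ u, f⟫_ℝ = ⟪u, N.pull M φ f⟫_ℝ := by
  rw [pull, ContinuousLinearMap.adjoint_inner_right]

theorem pull_push (N : ReproducingKernel U) (M : ReproducingKernel V) (φ : U → V)
    (h : ∀ x y, N x y = M (φ x) (φ y)) (u : N.H) : N.pull M φ (N.push M φ u) = u := by
  refine RKHS.ext fun y => ?_
  rw [pull_apply N M φ h, ← inner_gen, inner_push_left, pull_gen N M φ h, inner_gen]

theorem push_mem_closedSpan (N : ReproducingKernel U) (M : ReproducingKernel V) (φ : U → V)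
    (h : ∀ x y, N x y = M (φ x) (φ y)) (u : N.H) : N.push M φ u ∈ M.closedSpan (range φ) := by
  have hu : u ∈ N.closedSpan univ := N.proj_univ u ▸ N.proj_mem univ u
  have hle : N.closedSpan univ
      ≤ (M.closedSpan (range φ)).comap (N.push M φ).toLinearMap := by
    refine N.closedSpan_le
      ((M.isClosed_closedSpan _).preimage (N.push M φ).continuous) fun x _ => ?_
    change N.push M φ (N.gen x) ∈ M.closedSpan (range φ)
    rw [push_gen N M φ h]
    exact M.gen_mem_closedSpan ⟨x, rfl⟩
  exact hle hu

/-- The left side lies in the closed span of the generators over `range φ` and takes the values of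
`f` there, which characterises the projection. -/
theorem push_pull (N : ReproducingKernel U) (M : ReproducingKernel V) (φ : U → V)
    (h : ∀ x y, N x y = M (φ x) (φ y)) (f : M.H) :
    N.push M φ (N.pull M φ f) = M.proj (range φ) f := by
  refine (M.eq_proj (push_mem_closedSpan N M φ h _) ?_).symm
  rintro _ ⟨x, rfl⟩
  rw [← pull_apply N M φ h, pull_push N M φ h, pull_apply N M φ h]

theorem inner_pull_pull (N : ReproducingKernel U) (M : ReproducingKernel V) (φ : U → V)
    (h : ∀ x y, N x y = M (φ x) (φ y)) (f g : M.H) :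
    ⟪N.pull M φ f, N.pull M φ g⟫_ℝ = ⟪M.proj (range φ) f, g⟫_ℝ := by
  rw [← inner_push_left, push_pull N M φ h]

theorem norm_pull_sq (N : ReproducingKernel U) (M : ReproducingKernel V) (φ : U → V)
    (h : ∀ x y, N x y = M (φ x) (φ y)) (f : M.H) :
    ‖N.pull M φ f‖ ^ 2 = ‖M.proj (range φ) f‖ ^ 2 := by
  rw [norm_proj_sq, ← inner_pull_pull N M φ h, real_inner_self_eq_norm_sq]

/-- Translates the canonical condition into a statement about projections in the single space `L.H`.
-/
theorem inner_genOn (L : ReproducingKernel X) (A : Set X) (x y : X) :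
    ⟪L.genOn x A, L.genOn y A⟫_ℝ = ⟪L.proj A (L.gen x), L.gen y⟫_ℝ := by
  rw [genOn, genOn, inner_pull_pull (L.sub A) L Subtype.val fun _ _ => rfl, Subtype.range_coe]

/-! ### Conditional orthogonality -/

/-- The spans of `A` and `B` are orthogonal relative to the span of `C`. -/
def CondOrth (L : ReproducingKernel X) (A B C : Set X) : Prop :=
  ∀ x ∈ A, ∀ y ∈ B, L x y = ⟪L.proj C (L.gen x), L.gen y⟫_ℝ

theorem CondOrth.symm {L : ReproducingKernel X} {A B C : Set X} (h : L.CondOrth A B C) :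
    L.CondOrth B A C := fun x hx y hy => by
  rw [L.isReproducingKernel.1, h y hy x hx, inner_proj_left, real_inner_comm]

/-- Both sides are continuous and linear in each argument, so the identity passes from generators to
closed spans, one variable at a time. -/
theorem CondOrth.inner_eq {L : ReproducingKernel X} {A B C : Set X} (h : L.CondOrth A B C)
    {f g : L.H} (hf : f ∈ L.closedSpan A) (hg : g ∈ L.closedSpan B) :
    ⟪f, g⟫_ℝ = ⟪L.proj C f, g⟫_ℝ := by
  have h1 : ∀ x ∈ A, ⟪L.gen x, g⟫_ℝ = ⟪L.proj C (L.gen x), g⟫_ℝ := fun x hx =>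
    L.eqOn_closedSpan (innerSL ℝ (L.gen x)) (innerSL ℝ (L.proj C (L.gen x)))
      (fun y hy => by simpa [inner_gen_gen] using h x hx y hy) hg
  have h2 : ⟪g, f⟫_ℝ = ⟪L.proj C g, f⟫_ℝ :=
    L.eqOn_closedSpan (innerSL ℝ g) (innerSL ℝ (L.proj C g)) (fun x hx => by
      change ⟪g, L.gen x⟫_ℝ = ⟪L.proj C g, L.gen x⟫_ℝ
      rw [real_inner_comm, h1 x hx, inner_proj_left, real_inner_comm]) hf
  rw [real_inner_comm, h2, inner_proj_left, real_inner_comm]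

/-- Separation concerns only points outside the separator; this and the next lemma settle the points
inside it. -/
theorem condOrth_of_mem_left (L : ReproducingKernel X) {C : Set X} {x y : X} (hx : x ∈ C) :
    L x y = ⟪L.proj C (L.gen x), L.gen y⟫_ℝ := by
  rw [L.proj_gen hx, inner_gen_gen]

theorem condOrth_of_mem_right (L : ReproducingKernel X) {C : Set X} {x y : X} (hy : y ∈ C) :
    L x y = ⟪L.proj C (L.gen x), L.gen y⟫_ℝ := by
  rw [inner_proj_left, L.proj_gen hy, inner_gen_gen]

/-- Enlarging the separating set keeps conditional orthogonality. -/
theorem CondOrth.enlarge {L : ReproducingKernel X} {A B C S : Set X} (h : L.CondOrth A B C)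
    (hCA : C ⊆ A) (hCS : C ⊆ S) (hS : S ⊆ A ∪ B) : L.CondOrth A B S := by
  intro x hx y hy
  -- The aim is `w = P_S k_x`. The difference `k_x - w` lies in the span of `A` and vanishes on `C`,
  -- so it is orthogonal to the span of `B`; thus `w` agrees with `k_x` on `B` as well as on `S ∩
  -- A`.
  set w := L.proj (S ∩ A) (L.gen x) with hw
  have hwA : L.gen x - w ∈ L.closedSpan A :=
    sub_mem (L.gen_mem_closedSpan hx) (L.closedSpan_mono inter_subset_right (L.proj_mem _ _))
  have hC : L.proj C (L.gen x - w) = 0 := by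
    refine L.eq_proj (zero_mem _) fun z hz => ?_
    have hz' : z ∈ S ∩ A := ⟨hCS hz, hCA hz⟩
    rw [← L.inner_gen 0, inner_zero_left, ← inner_gen, inner_sub_left, hw, inner_gen, inner_gen,
      L.proj_apply_of_mem _ hz', sub_self]
  have hB : ∀ z ∈ B, w z = L.gen x z := fun z hz => by
    have := h.inner_eq hwA (L.gen_mem_closedSpan hz)
    rw [hC, inner_zero_left, inner_sub_left, inner_gen, inner_gen] at this
    linarith
  have hwS : L.proj S (L.gen x) = w := by
    refine L.eq_proj (L.closedSpan_mono inter_subset_left (L.proj_mem _ _)) fun z hz => ?_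
    rcases hS hz with hzA | hzB
    · exact L.proj_apply_of_mem _ ⟨hz, hzA⟩
    · exact hB z hzB
  rw [hwS, inner_gen, hB y hy, gen_apply]

/-- The right side lies in the span of `A ∪ B` and has the values of `f` there: on `A` the functions
`P_B f` and `P_C f` coincide, and symmetrically on `B`. -/
theorem CondOrth.proj_union {L : ReproducingKernel X} {A B C : Set X} (h : L.CondOrth A B C)
    (hA : C ⊆ A) (hB : C ⊆ B) (f : L.H) :
    L.proj (A ∪ B) f = L.proj A f + L.proj B f - L.proj C f := by
  have key : ∀ {A B : Set X}, L.CondOrth A B C → C ⊆ B → ∀ x ∈ A,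
      ⟪L.proj B f, L.gen x⟫_ℝ = ⟪L.proj C f, L.gen x⟫_ℝ := by
    intro A B h hB x hx
    rw [real_inner_comm, h.inner_eq (L.gen_mem_closedSpan hx) (L.proj_mem B f),
      ← inner_proj_left, L.proj_proj_of_subset hB, inner_proj_left, real_inner_comm]
  refine L.eq_proj ?_ fun x hx => ?_
  · exact sub_mem (add_mem (L.closedSpan_mono subset_union_left (L.proj_mem A f))
      (L.closedSpan_mono subset_union_right (L.proj_mem B f)))
      (L.closedSpan_mono (hA.trans subset_union_left) (L.proj_mem C f))
  · rw [← inner_gen, inner_sub_left, inner_add_left]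
    rcases hx with hx | hx
    · rw [key h hB x hx, inner_gen, L.proj_apply_of_mem f hx]
      ring
    · rw [key h.symm hA x hx, inner_gen, inner_gen, L.proj_apply_of_mem f hx]
      ring

theorem CondOrth.norm_proj_union {L : ReproducingKernel X} {A B C : Set X}
    (h : L.CondOrth A B C) (hA : C ⊆ A) (hB : C ⊆ B) (f : L.H) :
    ‖L.proj (A ∪ B) f‖ ^ 2 = ‖L.proj A f‖ ^ 2 + ‖L.proj B f‖ ^ 2 - ‖L.proj C f‖ ^ 2 := by
  rw [norm_proj_sq, norm_proj_sq, norm_proj_sq, norm_proj_sq, h.proj_union hA hB,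
    inner_sub_left, inner_add_left]

/-! ### Gluing two kernels -/

/-- Realise `G` by a feature map into `L.H ⊕ M.H`: points of `A` keep their generator in the first
summand, and points of `B` have their `C`-component transplanted there while the rest, orthogonal to
the span of `C`, goes into the second. Then `A` and `B` interact only through `C`. -/
theorem exists_glue (L : ReproducingKernel X) (A B C : Set X) (hC : A ∩ B = C)
    (M : ReproducingKernel B) (N : ReproducingKernel C) (hCB : C ⊆ B)
    (hL : ∀ x y : C, N x y = L x y)
    (hM : ∀ x y : C, N x y = M (inclusion hCB x) (inclusion hCB y)) :
    ∃ G : ReproducingKernel X, (∀ x ∈ A, ∀ y ∈ A, G x y = L x y) ∧ (∀ x y : B, G x y = M x y) ∧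
      ∀ x ∈ A, ∀ y : B, G x y
        = ⟪N.pull L Subtype.val (L.gen x), N.pull M (inclusion hCB) (M.gen y)⟫_ℝ := by
  classical
  set P := N.pull M (inclusion hCB) with hP
  set J := N.push M (inclusion hCB) with hJ
  set I := N.push L Subtype.val with hI
  let θ : B → WithLp 2 (L.H × M.H) := fun y =>
    WithLp.toLp 2 (I (P (M.gen y)), M.gen y - J (P (M.gen y)))
  let η : X → WithLp 2 (L.H × M.H) := fun x => WithLp.toLp 2 (L.gen x, 0)
  -- The value `0` outside `A ∪ B` is arbitrary. On `A ∩ B = C` the two prescriptions agree because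
  -- the remainder vanishes.
  let φ : X → WithLp 2 (L.H × M.H) := fun x =>
    if x ∈ A then η x else if h : x ∈ B then θ ⟨x, h⟩ else 0
  have hφA : ∀ x ∈ A, φ x = η x := fun x hx => if_pos hx
  have hφB : ∀ y : B, φ y = θ y := by
    intro y
    by_cases hy : (y : X) ∈ A
    · have hyC : (y : X) ∈ C := hC ▸ ⟨hy, y.2⟩
      have e : P (M.gen y) = N.gen ⟨y, hyC⟩ :=
        pull_gen N M (inclusion hCB) hM ⟨y, hyC⟩
      have e1 : I (N.gen ⟨y, hyC⟩) = L.gen y := push_gen N L Subtype.val hL ⟨y, hyC⟩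
      have e2 : J (N.gen ⟨y, hyC⟩) = M.gen y := push_gen N M (inclusion hCB) hM ⟨y, hyC⟩
      rw [hφA _ hy]
      simp only [η, θ, e, e1, e2, sub_self]
    · simp [φ, hy]
  refine ⟨ofFeature φ, fun x hx y hy => ?_, fun x y => ?_, fun x hx y => ?_⟩
  · rw [ofFeature_apply, hφA x hx, hφA y hy]
    simp [η, inner_gen_gen]
  · have h1 : ⟪I (P (M.gen x)), I (P (M.gen y))⟫_ℝ = ⟪P (M.gen x), P (M.gen y)⟫_ℝ := by
      rw [hI, inner_push_left, pull_push N L _ hL]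
    have h2 : ⟪J (P (M.gen x)), J (P (M.gen y))⟫_ℝ = ⟪P (M.gen x), P (M.gen y)⟫_ℝ := by
      rw [hJ, inner_push_left, pull_push N M _ hM]
    have h3 : ⟪J (P (M.gen x)), M.gen y⟫_ℝ = ⟪P (M.gen x), P (M.gen y)⟫_ℝ := by
      rw [hJ, inner_push_left]
    have h4 : ⟪M.gen x, J (P (M.gen y))⟫_ℝ = ⟪P (M.gen x), P (M.gen y)⟫_ℝ := by
      rw [real_inner_comm, hJ, inner_push_left, real_inner_comm]
    -- The first summand contributes `⟪P k_x, P k_y⟫` and the second `M x y` minus the same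
    -- quantity.
    rw [ofFeature_apply, hφB, hφB]
    simp only [θ, WithLp.prod_inner_apply, inner_sub_left, inner_sub_right, h1, h2, h3, h4,
      inner_gen_gen]
    ring
  · rw [ofFeature_apply, hφA x hx, hφB]
    simp only [θ, η, WithLp.prod_inner_apply, inner_zero_left, add_zero]
    rw [real_inner_comm, hI, inner_push_left, real_inner_comm]

end ReproducingKernel

open ReproducingKernel

variable {X : Type*} {Ω : Set (X × X)}

/-! ### Chains of sets -/

/-- `T 0, T 1, …` cover `X`, every point lies in an interval of them, and `Ω` is the union of the
squares. -/
structure IsChain (Ω : Set (X × X)) (T : ℕ → Set X) : Prop where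
  cover : ∀ x, ∃ j, x ∈ T j
  inter_subset : ∀ {i j k x}, i ≤ j → j ≤ k → x ∈ T i → x ∈ T k → x ∈ T j
  mem_iff : ∀ {x y}, (x, y) ∈ Ω ↔ ∃ j, x ∈ T j ∧ y ∈ T j

/-- The serrated domain indexed by the natural numbers, with constant tail. -/
def extendIndex {n : ℕ} (S : Fin (n + 1) → Set X) (j : ℕ) : Set X :=
  S ⟨min j n, Nat.lt_succ_of_le (min_le_right j n)⟩

theorem extendIndex_of_le {n : ℕ} (S : Fin (n + 1) → Set X) {j : ℕ} (hj : j < n + 1) :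
    extendIndex S j = S ⟨j, hj⟩ := by
  have h : min j n = j := min_eq_left (Nat.le_of_lt_succ hj)
  simp only [extendIndex, h]

theorem extendIndex_of_ge {n : ℕ} (S : Fin (n + 1) → Set X) {j : ℕ} (hj : n ≤ j) :
    extendIndex S j = extendIndex S n := by
  simp only [extendIndex, min_eq_right hj, min_self]

theorem IsSerrated.isChain {n : ℕ} {S : Fin (n + 1) → Set X} (h : IsSerrated Ω S) :
    IsChain Ω (extendIndex S) where
  cover x := by
    obtain ⟨j, hj⟩ := mem_iUnion.mp (h.cover ▸ mem_univ x)
    exact ⟨j, by rwa [extendIndex_of_le S j.2]⟩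
  inter_subset := by
    intro i j k x hij hjk hi hk
    -- Truncated indices may coincide, and then the membership is already given; otherwise the
    -- serration condition applies.
    rcases (show min i n ≤ min j n by omega).eq_or_lt with e | hlt
    · simpa only [extendIndex, e] using hi
    rcases (show min j n ≤ min k n by omega).eq_or_lt with e | hlt'
    · simpa only [extendIndex, e] using hk
    exact (h.inter_subset ⟨min i n, by omega⟩ ⟨min j n, by omega⟩ ⟨min k n, by omega⟩ hlt hlt'
      ⟨hi, hk⟩).2
  mem_iff := by
    intro x y
    rw [h.eq_iUnion, mem_iUnion]
    constructor
    · rintro ⟨j, hx, hy⟩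
      exact ⟨j, by rw [extendIndex_of_le S j.2]; exact ⟨hx, hy⟩⟩
    · rintro ⟨j, hx, hy⟩
      exact ⟨_, hx, hy⟩

/-- The union of `T 0, …, T j`. -/
def initial (T : ℕ → Set X) (j : ℕ) : Set X := {x | ∃ i ≤ j, x ∈ T i}

theorem subset_initial {T : ℕ → Set X} {i j : ℕ} (h : i ≤ j) : T i ⊆ initial T j :=
  fun _ hx => ⟨i, h, hx⟩

theorem initial_mono {T : ℕ → Set X} {i j : ℕ} (h : i ≤ j) : initial T i ⊆ initial T j :=
  fun _ ⟨k, hk, hx⟩ => ⟨k, hk.trans h, hx⟩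

theorem initial_zero (T : ℕ → Set X) : initial T 0 = T 0 :=
  Subset.antisymm (fun _ ⟨_, hi, hx⟩ => Nat.le_zero.mp hi ▸ hx) (subset_initial le_rfl)

theorem initial_succ (T : ℕ → Set X) (j : ℕ) : initial T (j + 1) = initial T j ∪ T (j + 1) := by
  ext x
  constructor
  · rintro ⟨i, hi, hx⟩
    rcases Nat.le_succ_iff.mp hi with h | rfl
    · exact Or.inl ⟨i, h, hx⟩
    · exact Or.inr hx
  · rintro (h | h)
    · exact initial_mono j.le_succ h
    · exact subset_initial le_rfl h

namespace IsChain

variable {T : ℕ → Set X}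

theorem isClique (hT : IsChain Ω T) (j : ℕ) : IsClique Ω (T j) :=
  fun _ hp => hT.mem_iff.mpr ⟨j, hp.1, hp.2⟩

/-- The indices of the sets containing `x` form an interval, which here meets both `[0, j]` and `[j
+ 1, ∞)`. -/
theorem mem_inter_succ (hT : IsChain Ω T) {j k : ℕ} (hjk : j < k) {x : X}
    (hx : x ∈ initial T j) (hk : x ∈ T k) : x ∈ T j ∩ T (j + 1) := by
  obtain ⟨i, hi, hxi⟩ := hx
  exact ⟨hT.inter_subset hi hjk.le hxi hk, hT.inter_subset (by omega) hjk hxi hk⟩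

theorem initial_inter (hT : IsChain Ω T) (j : ℕ) :
    initial T j ∩ T (j + 1) = T j ∩ T (j + 1) :=
  Subset.antisymm (fun _ hx => hT.mem_inter_succ j.lt_succ_self hx.1 hx.2)
    (inter_subset_inter_left _ (subset_initial le_rfl))

/-- The intersection of two consecutive sets separates the points before it from those after. -/
theorem separates (hT : IsChain Ω T) {j k : ℕ} (hjk : j < k) {x y : X} (hx : x ∈ initial T j)
    (hy : y ∈ T k) (hxC : x ∉ T j ∩ T (j + 1)) (hyC : y ∉ T j ∩ T (j + 1)) :
    Separates Ω (T j ∩ T (j + 1)) x y := by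
  classical
  refine ⟨hxC, hyC, fun m z ⟨h0, h1, hz⟩ => ?_⟩
  -- Take the first exit from `initial T j`. The edge leaving it lies in some `T k'` with `j < k'`,
  -- so its starting point lies in `initial T j` and in a later set, hence in `T j ∩ T (j + 1)`. It
  -- is not the endpoint `x`, which lies outside this intersection.
  have hex : ∃ l, z l ∉ initial T j :=
    ⟨m + 1, fun h => hyC (hT.mem_inter_succ hjk (h1 ▸ h) hy)⟩
  obtain ⟨l, hl⟩ : ∃ l, Nat.find hex = l + 1 := by
    refine Nat.exists_eq_succ_of_ne_zero fun h => Nat.find_spec hex ?_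
    rw [h, h0]
    exact hx
  have hlast : z (l + 1) ∉ initial T j := hl ▸ Nat.find_spec hex
  have hzl : z l ∈ initial T j := by
    by_contra h
    have := Nat.find_min' hex h
    omega
  have hlm : l ≤ m := by
    have : Nat.find hex ≤ m + 1 :=
      Nat.find_min' hex fun h => hyC (hT.mem_inter_succ hjk (h1 ▸ h) hy)
    omega
  obtain ⟨k', ha, hb⟩ := hT.mem_iff.mp (hz l hlm)
  have hk' : j < k' := by
    by_contra h
    exact hlast ⟨k', by omega, hb⟩
  have hmem := hT.mem_inter_succ hk' hzl ha
  refine ⟨l, Nat.one_le_iff_ne_zero.mpr ?_, hlm, hmem⟩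
  rintro rfl
  exact hxC (h0 ▸ hmem)

/-- A separating set contains the intersection of two consecutive sets. -/
theorem exists_inter_subset (hT : IsChain Ω T) {A : Set X} {i k : ℕ} (hik : i ≤ k) {x y : X}
    (hx : x ∈ T i) (hy : y ∈ T k) (h : Separates Ω A x y) :
    ∃ j, i ≤ j ∧ j < k ∧ T j ∩ T (j + 1) ⊆ A := by
  by_contra! hcon
  have hw : ∀ j, ∃ w, i ≤ j → j < k → (w ∈ T j ∩ T (j + 1) ∧ w ∉ A) := by
    intro j
    by_cases hj : i ≤ j ∧ j < k
    · obtain ⟨w, hw⟩ := not_subset.mp (hcon j hj.1 hj.2)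
      exact ⟨w, fun _ _ => hw⟩
    · exact ⟨x, fun h1 h2 => absurd ⟨h1, h2⟩ hj⟩
  choose w hw using hw
  -- The path `x, w i, …, w (k - 1), y`; its step `l` stays inside `T (i + l)`. For `i = k` it is a
  -- single edge with no interior point.
  let z : ℕ → X := fun l => if l = 0 then x else if l ≤ k - i then w (i + l - 1) else y
  have hz1 : ∀ l, l ≤ k - i → z l ∈ T (i + l) := by
    intro l hl
    by_cases h0 : l = 0
    · simpa [z, h0] using hx
    · have := (hw (i + l - 1) (by omega) (by omega)).1.2
      rw [show i + l - 1 + 1 = i + l by omega] at this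
      simpa [z, h0, hl] using this
  have hz2 : ∀ l, l ≤ k - i → z (l + 1) ∈ T (i + l) := by
    intro l hl
    by_cases h0 : l + 1 ≤ k - i
    · simpa [z, h0] using (hw (i + l) (by omega) (by omega)).1.1
    · have e : i + l = k := by omega
      simpa [z, h0, e] using hy
  have hpath : IsPath Ω x y (k - i) z := by
    refine ⟨by simp [z], by simp [z], fun l hl => hT.mem_iff.mpr ⟨i + l, hz1 l hl, hz2 l hl⟩⟩
  obtain ⟨l, hl1, hl2, hl3⟩ := h.2.2 _ z hpath
  have : z l = w (i + l - 1) := by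
    simp [z, hl2, show l ≠ 0 by omega]
  exact (hw (i + l - 1) (by omega) (by omega)).2 (this ▸ hl3)

end IsChain

theorem Separates.symm (hΩ : ∀ x y, (x, y) ∈ Ω → (y, x) ∈ Ω) {A : Set X} {x y : X}
    (h : Separates Ω A x y) : Separates Ω A y x := by
  refine ⟨h.2.1, h.1, fun m z ⟨h0, h1, hz⟩ => ?_⟩
  -- Apply the hypothesis to the reversed path.
  obtain ⟨l, hl1, hl2, hl3⟩ := h.2.2 m (fun l => z (m + 1 - l))
    ⟨by simpa using h1, by simpa using h0, fun l hl => by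
      have := hΩ _ _ (hz (m - l) (by omega))
      rwa [show m - l + 1 = m + 1 - l by omega, show m - l = m + 1 - (l + 1) by omega] at this⟩
  exact ⟨m + 1 - l, by omega, by omega, hl3⟩

/-! ### Markov kernels along a chain -/

/-- Conditional orthogonality of each set of the chain and its predecessors. -/
def IsMarkov (L : ReproducingKernel X) (T : ℕ → Set X) : Prop :=
  ∀ j, L.CondOrth (initial T j) (T (j + 1)) (T j ∩ T (j + 1))

namespace IsMarkov

variable {L : ReproducingKernel X} {T : ℕ → Set X}

theorem condOrth (h : IsMarkov L T) {j k : ℕ} (hjk : j < k) :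
    L.CondOrth (initial T j) (T k) (T j ∩ T (j + 1)) := by
  induction k, hjk using Nat.le_induction with
  | base => exact h j
  | succ k hjk ih =>
    intro x hx y hy
    have hxk : x ∈ initial T k := initial_mono (Nat.le_of_succ_le hjk) hx
    have hmem : L.proj (T j ∩ T (j + 1)) (L.gen x) ∈ L.closedSpan (initial T k) :=
      L.closedSpan_mono (inter_subset_left.trans (subset_initial (Nat.le_of_succ_le hjk)))
        (L.proj_mem _ _)
    -- Write `C_k = T k ∩ T (k + 1)`. Since `P_{C_k} k_y` lies in the span of `T k`, the induction
    -- hypothesis inserts `P_{C_j}`; then `P_{C_k}` is removed by the Markov property at `k`, as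
    -- `P_{C_j} k_x` lies in the span of `initial T k`.
    rw [h k x hxk y hy, inner_proj_left,
      ih.inner_eq (L.gen_mem_closedSpan hx)
        (L.closedSpan_mono inter_subset_left (L.proj_mem _ _)),
      ← inner_proj_left, ← (h k).inner_eq hmem (L.gen_mem_closedSpan hy)]

theorem eq_inner_proj_of_separates (h : IsMarkov L T) (hT : IsChain Ω T) {A : Set X} {i k : ℕ}
    (hik : i ≤ k) {x y : X} (hx : x ∈ T i) (hy : y ∈ T k) (hA : Separates Ω A x y) :
    L x y = ⟪L.proj A (L.gen x), L.gen y⟫_ℝ := by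
  obtain ⟨j, hij, hjk, hjA⟩ := hT.exists_inter_subset hik hx hy hA
  -- Taking all later sets together makes the two sides cover `X`, so that any separator can be
  -- reached by enlargement.
  have hco : L.CondOrth (initial T j) {y | ∃ k, j < k ∧ y ∈ T k} (T j ∩ T (j + 1)) :=
    fun x hx y ⟨_, hk, hy⟩ => h.condOrth hk x hx y hy
  refine hco.enlarge (inter_subset_left.trans (subset_initial le_rfl)) hjA ?_ x ⟨i, hij, hx⟩ y
    ⟨k, hjk, hy⟩
  intro z _
  obtain ⟨l, hl⟩ := hT.cover z
  rcases le_or_gt l j with hlj | hlj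
  · exact Or.inl ⟨l, hlj, hl⟩
  · exact Or.inr ⟨l, hlj, hl⟩

theorem eq_inner_genOn (h : IsMarkov L T) (hT : IsChain Ω T) {A : Set X} {x y : X}
    (hA : Separates Ω A x y) : L x y = ⟪L.genOn x A, L.genOn y A⟫_ℝ := by
  rw [inner_genOn]
  obtain ⟨i, hi⟩ := hT.cover x
  obtain ⟨k, hk⟩ := hT.cover y
  rcases le_total i k with hik | hki
  · exact h.eq_inner_proj_of_separates hT hik hi hk hA
  · have hsymm : ∀ x y, (x, y) ∈ Ω → (y, x) ∈ Ω := fun x y hxy => by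
      obtain ⟨j, h1, h2⟩ := hT.mem_iff.mp hxy
      exact hT.mem_iff.mpr ⟨j, h2, h1⟩
    rw [L.isReproducingKernel.1, h.eq_inner_proj_of_separates hT hki hk hi (hA.symm hsymm),
      inner_proj_left, real_inner_comm]

theorem norm_proj_initial (h : IsMarkov L T) (f : L.H) (m : ℕ) :
    ‖L.proj (initial T m) f‖ ^ 2 = ∑ j ∈ Finset.range (m + 1), ‖L.proj (T j) f‖ ^ 2
      - ∑ j ∈ Finset.range m, ‖L.proj (T j ∩ T (j + 1)) f‖ ^ 2 := by
  induction m with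
  | zero => simp [initial_zero]
  | succ m ih =>
    rw [initial_succ, (h m).norm_proj_union (inter_subset_left.trans (subset_initial le_rfl))
      inter_subset_right, ih]
    simp only [Finset.sum_range_succ]
    ring

end IsMarkov

/-! ### Canonical completions are Markov; existence by successive gluing. -/

namespace PartialKernel

variable {T : ℕ → Set X} {K : PartialKernel Ω} {L : ReproducingKernel X}

theorem IsCompletion.sub_apply (hL : K.IsCompletion L) {A : Set X} (hA : IsClique Ω A)
    (x y : A) : K.sub A hA x y = L x y :=
  (hL ⟨(x, y), hA.mem x.2 y.2⟩).symm

theorem IsCanonicalCompletion.isMarkov (hL : K.IsCanonicalCompletion L) (hT : IsChain Ω T) :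
    IsMarkov L T := by
  intro j x hx y hy
  by_cases hxC : x ∈ T j ∩ T (j + 1)
  · exact L.condOrth_of_mem_left hxC
  by_cases hyC : y ∈ T j ∩ T (j + 1)
  · exact L.condOrth_of_mem_right hyC
  rw [← inner_genOn]
  exact hL.2 _ x y (hT.separates j.lt_succ_self hx hy hxC hyC)

theorem pull_inclusion_apply (K : PartialKernel Ω) {A B : Set X} (hA : IsClique Ω A)
    (hB : IsClique Ω B) (h : A ⊆ B) (f : (K.sub B hB).H) (x : A) :
    (K.sub A hA).pull (K.sub B hB) (inclusion h) f x = f (inclusion h x) :=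
  pull_apply (K.sub A hA) (K.sub B hB) (inclusion h) (fun _ _ => rfl) f x

theorem push_inclusion_gen (K : PartialKernel Ω) {A B : Set X} (hA : IsClique Ω A)
    (hB : IsClique Ω B) (h : A ⊆ B) (x : A) :
    (K.sub A hA).push (K.sub B hB) (inclusion h) ((K.sub A hA).gen x)
      = (K.sub B hB).gen (inclusion h x) :=
  push_gen (K.sub A hA) (K.sub B hB) (inclusion h) (fun _ _ => rfl) x

/-- Completions over an initial part of the chain. -/
theorem exists_markov_initial (K : PartialKernel Ω) (hT : IsChain Ω T) (m : ℕ) :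
    ∃ L : ReproducingKernel X,
      (∀ i ≤ m, ∀ x y : T i, L x y = K.sub (T i) (hT.isClique i) x y) ∧
      ∀ j < m, ∀ x ∈ initial T j, ∀ y ∈ T (j + 1), L x y =
        ⟪(K.sub (T j ∩ T (j + 1)) ((hT.isClique j).mono inter_subset_left)).pull L
            Subtype.val (L.gen x),
          (K.sub (T j ∩ T (j + 1)) ((hT.isClique j).mono inter_subset_left)).pull L
            Subtype.val (L.gen y)⟫_ℝ := by
  classical
  induction m with
  | zero =>
    let M := K.sub (T 0) (hT.isClique 0)
    -- Extension by zero off `T 0`: the kernel lives on all of `X`, but it is constrained only on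
    -- the first sets of the chain.
    refine ⟨ofFeature fun x => if h : x ∈ T 0 then M.gen ⟨x, h⟩ else 0, ?_, by simp⟩
    intro i hi x y
    obtain rfl := Nat.le_zero.mp hi
    simp [ofFeature_apply, inner_gen_gen, M]
  | succ m ih =>
    obtain ⟨L, hL, hLM⟩ := ih
    set C := T m ∩ T (m + 1)
    set N := K.sub C ((hT.isClique m).mono inter_subset_left)
    have hNL : ∀ x y : C, N x y = L x y := fun x y =>
      (hL m le_rfl ⟨x, x.2.1⟩ ⟨y, y.2.1⟩).symm
    obtain ⟨G, hGA, hGB, hG⟩ := L.exists_glue (initial T m) (T (m + 1)) C (hT.initial_inter m)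
      (K.sub (T (m + 1)) (hT.isClique (m + 1))) N inter_subset_right hNL (fun _ _ => rfl)
    have hGK : ∀ i ≤ m + 1, ∀ x y : T i, G x y = K.sub (T i) (hT.isClique i) x y := by
      intro i hi x y
      rcases Nat.le_succ_iff.mp hi with h | rfl
      · rw [hGA x (subset_initial h x.2) y (subset_initial h y.2), hL i h]
      · exact hGB x y
    refine ⟨G, hGK, fun j hj x hx y hy => ?_⟩
    rcases Nat.lt_succ_iff_lt_or_eq.mp hj with hj' | rfl
    · have hpull : ∀ z ∈ initial T m,
          (K.sub (T j ∩ T (j + 1)) ((hT.isClique j).mono inter_subset_left)).pull G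
            Subtype.val (G.gen z)
          = (K.sub (T j ∩ T (j + 1)) ((hT.isClique j).mono inter_subset_left)).pull L
            Subtype.val (L.gen z) := by
        intro z hz
        refine RKHS.ext fun c => ?_
        rw [pull_apply _ G Subtype.val fun a b =>
            (hGK j (by omega) ⟨a, a.2.1⟩ ⟨b, b.2.1⟩).symm,
          pull_apply _ L Subtype.val fun a b => (hL j (by omega) ⟨a, a.2.1⟩ ⟨b, b.2.1⟩).symm,
          gen_apply, gen_apply, hGA z hz c (subset_initial hj'.le c.2.1)]
      have hx' : x ∈ initial T m := initial_mono hj'.le hx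
      have hy' : y ∈ initial T m := subset_initial hj' hy
      rw [hpull x hx', hpull y hy', ← hLM j hj' x hx y hy, hGA x hx' y hy']
    · have hNG : ∀ a b : C, N a b = G a b := fun a b =>
        (hGK j (by omega) ⟨a, a.2.1⟩ ⟨b, b.2.1⟩).symm
      have e1 : N.pull G Subtype.val (G.gen x) = N.pull L Subtype.val (L.gen x) :=
        RKHS.ext fun c => by
          rw [pull_apply _ G _ hNG, pull_apply _ L _ hNL, gen_apply, gen_apply,
            hGA x hx c (subset_initial le_rfl c.2.1)]
      have e2 : N.pull G Subtype.val (G.gen y) = N.pull (K.sub (T (j + 1)) (hT.isClique (j + 1)))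
          (inclusion inter_subset_right) (gen _ ⟨y, hy⟩) :=
        RKHS.ext fun c => by
          rw [pull_apply _ G _ hNG, pull_inclusion_apply, gen_apply, gen_apply]
          exact hGB ⟨y, hy⟩ ⟨c, c.2.2⟩
      change G x y = ⟪N.pull G Subtype.val (G.gen x), N.pull G Subtype.val (G.gen y)⟫_ℝ
      rw [e1, e2]
      exact hG x hx ⟨y, hy⟩

theorem exists_canonicalCompletion {n : ℕ} {S : Fin (n + 1) → Set X} (hΩ : IsSerrated Ω S)
    (K : PartialKernel Ω) : ∃ L : ReproducingKernel X, K.IsCanonicalCompletion L := by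
  have hT := hΩ.isChain
  obtain ⟨L, hL, hLM⟩ := K.exists_markov_initial hT n
  have hcompl : K.IsCompletion L := by
    rintro ⟨⟨x, y⟩, hxy⟩
    obtain ⟨j, hx, hy⟩ := hT.mem_iff.mp hxy
    rcases le_total j n with hj | hj
    · exact hL j hj ⟨x, hx⟩ ⟨y, hy⟩
    · rw [extendIndex_of_ge S hj] at hx hy
      exact hL n le_rfl ⟨x, hx⟩ ⟨y, hy⟩
  have hM : IsMarkov L (extendIndex S) := by
    intro j x hx y hy
    rcases lt_or_ge j n with hj | hj
    · rw [hLM j hj x hx y hy, inner_pull_pull _ _ _ (hcompl.sub_apply _), Subtype.range_coe]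
    · refine L.condOrth_of_mem_right ⟨?_, hy⟩
      rwa [extendIndex_of_ge S hj, ← extendIndex_of_ge S (hj.trans j.le_succ)]
  exact ⟨L, hcompl, fun A x y hA => hM.eq_inner_genOn hT hA⟩

/-! ### The product of links -/

/-- Contracting to a subset is restriction, and contracting to a superset is the isometric
embedding, the adjoint of restriction; moving the latter across the inner product leaves two
restrictions. -/
theorem link_inner_gen (K : PartialKernel Ω) (B A : Set X) (hB : IsClique Ω B)
    (hA : IsClique Ω A) (f : (K.sub A hA).H) (y : B) :
    ⟪K.link B A hB hA f, (K.sub B hB).gen y⟫_ℝ =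
      ⟪(K.sub (B ∩ A) (hB.mono inter_subset_left)).pull (K.sub A hA)
          (inclusion inter_subset_right) f,
        (K.sub (B ∩ A) (hB.mono inter_subset_left)).pull (K.sub B hB)
          (inclusion inter_subset_left) ((K.sub B hB).gen y)⟫_ℝ := by
  have h1 : K.contraction (B ∩ A) A (hA.mono (union_subset subset_rfl inter_subset_right))
      = (K.sub (B ∩ A) (hB.mono inter_subset_left)).pull (K.sub A hA)
          (inclusion inter_subset_right) := by
    refine (K.contraction_unique (B ∩ A) A
      (hA.mono (union_subset subset_rfl inter_subset_right)) _ fun x y => ?_).symm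
    exact (K.pull_inclusion_apply _ hA inter_subset_right _ y).trans (gen_apply _ _ _)
  have h2 : K.contraction B (B ∩ A) (hB.mono (union_subset inter_subset_left subset_rfl))
      = (K.sub (B ∩ A) (hB.mono inter_subset_left)).push (K.sub B hB)
          (inclusion inter_subset_left) := by
    refine (K.contraction_unique B (B ∩ A)
      (hB.mono (union_subset inter_subset_left subset_rfl)) _ fun x y => ?_).symm
    rw [K.push_inclusion_gen _ hB inter_subset_left, gen_apply]
    rfl
  rw [link, h1, h2, ContinuousLinearMap.comp_apply, inner_push_left]

theorem link_restrict_apply (hL : K.IsCompletion L) (B A : Set X) (hB : IsClique Ω B)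
    (hA : IsClique Ω A) (f : L.H) (y : B) :
    K.link B A hB hA (K.restrict L A hA f) y = ⟪L.proj (B ∩ A) f, L.gen y⟫_ℝ := by
  set N := K.sub (B ∩ A) (hB.mono inter_subset_left)
  have hNL : ∀ a b : ↥(B ∩ A), N a b = L a b := hL.sub_apply _
  have e1 : N.pull (K.sub A hA) (inclusion inter_subset_right) (K.restrict L A hA f)
      = N.pull L Subtype.val f :=
    RKHS.ext fun c => by
      rw [pull_inclusion_apply, pull_apply _ _ _ hNL, restrict_apply K L hL]
  have e2 : N.pull (K.sub B hB) (inclusion inter_subset_left) ((K.sub B hB).gen y)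
      = N.pull L Subtype.val (L.gen y) :=
    RKHS.ext fun c => by
      rw [pull_inclusion_apply, pull_apply _ _ _ hNL, gen_apply, gen_apply,
        hL.sub_apply hB]
  rw [← inner_gen, link_inner_gen]
  change ⟪N.pull _ _ _, N.pull _ _ _⟫_ℝ = _
  rw [e1, e2, inner_pull_pull _ _ _ hNL, Subtype.range_coe]

theorem norm_restrict_sq (hL : K.IsCompletion L) (A : Set X) (hA : IsClique Ω A) (f : L.H) :
    ‖K.restrict L A hA f‖ ^ 2 = ‖L.proj A f‖ ^ 2 := by
  rw [restrict, norm_pull_sq _ _ _ (hL.sub_apply hA), Subtype.range_coe]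

/-! ### Product formula, uniqueness and norm identity. -/

variable {n : ℕ} {S : Fin (n + 1) → Set X}

/-- A link gives the values on `S (j + 1)` of the projection of `k_x` onto the span of `S j ∩ S (j +
1)`; by the Markov property these are the values of `k_x` itself. -/
theorem IsCanonicalCompletion.linkProd_gen (hL : K.IsCanonicalCompletion L)
    (hΩ : IsSerrated Ω S) (i : Fin (n + 1)) (x : S i) {j : ℕ} (hij : (i : ℕ) ≤ j)
    (hj : j < n + 1) :
    K.linkProd S hΩ.isClique i hij hj ((K.sub (S i) (hΩ.isClique i)).gen x)
      = K.restrict L (S ⟨j, hj⟩) (hΩ.isClique _) (L.gen x) := by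
  induction j, hij using Nat.le_induction with
  | base =>
    rw [K.linkProd_self S hΩ.isClique i]
    refine RKHS.ext fun y => ?_
    rw [restrict_apply K L hL.1, gen_apply, ContinuousLinearMap.id_apply, gen_apply,
      hL.1.sub_apply]
  | succ j hij ih =>
    rw [K.linkProd_succ S hΩ.isClique i hij hj, ContinuousLinearMap.comp_apply, ih]
    refine RKHS.ext fun y => ?_
    have hM := hL.isMarkov hΩ.isChain j x
      ⟨i, hij, by rw [extendIndex_of_le S i.2]; exact x.2⟩ y
      (by rw [extendIndex_of_le S hj]; exact y.2)
    rw [extendIndex_of_le S hj, extendIndex_of_le S (j.lt_succ_self.trans hj)] at hM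
    rw [link_restrict_apply hL.1, restrict_apply K L hL.1, gen_apply, hM, inter_comm]

/-- The case `i = j`, with empty product, is included so that uniqueness follows for all pairs of
points. -/
theorem IsCanonicalCompletion.apply_eq (hL : K.IsCanonicalCompletion L) (hΩ : IsSerrated Ω S)
    {i j : Fin (n + 1)} (hij : i ≤ j) (x : S i) (y : S j) :
    L x y = ⟪K.linkProd S hΩ.isClique i hij j.2 ((K.sub (S i) (hΩ.isClique i)).gen x),
      (K.sub (S j) (hΩ.isClique j)).gen y⟫_ℝ := by
  rw [hL.linkProd_gen hΩ i x hij j.2, inner_gen, restrict_apply K L hL.1, gen_apply]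

theorem IsCanonicalCompletion.unique {L' : ReproducingKernel X} (hL : K.IsCanonicalCompletion L)
    (hL' : K.IsCanonicalCompletion L') (hΩ : IsSerrated Ω S) : L = L' := by
  have key : ∀ {i j : Fin (n + 1)}, i ≤ j → ∀ x ∈ S i, ∀ y ∈ S j, L x y = L' x y :=
    fun hij x hx y hy =>
      (hL.apply_eq hΩ hij ⟨x, hx⟩ ⟨y, hy⟩).trans (hL'.apply_eq hΩ hij ⟨x, hx⟩ ⟨y, hy⟩).symm
  have hcover : ∀ x, ∃ i, x ∈ S i := fun x => mem_iUnion.mp (hΩ.cover ▸ mem_univ x)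
  refine ReproducingKernel.ext (funext fun x => funext fun y => ?_)
  obtain ⟨i, hi⟩ := hcover x
  obtain ⟨j, hj⟩ := hcover y
  rcases le_total i j with hij | hji
  · exact key hij x hi y hj
  · rw [L.isReproducingKernel.1, L'.isReproducingKernel.1]
    exact key hji y hj x hi

theorem IsCanonicalCompletion.norm_sq (hL : K.IsCanonicalCompletion L) (hΩ : IsSerrated Ω S)
    (f : L.H) :
    ‖f‖ ^ 2 = ∑ j : Fin (n + 1), ‖K.restrict L (S j) (hΩ.isClique j) f‖ ^ 2
      - ∑ j : Fin n, ‖K.restrict L (S j.castSucc ∩ S j.succ)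
          ((hΩ.isClique j.castSucc).mono inter_subset_left) f‖ ^ 2 := by
  have huniv : initial (extendIndex S) n = univ := by
    refine eq_univ_of_forall fun x => ?_
    obtain ⟨j, hj⟩ := mem_iUnion.mp (hΩ.cover ▸ mem_univ x)
    exact ⟨j, Nat.le_of_lt_succ j.2, by rwa [extendIndex_of_le S j.2]⟩
  have h := (hL.isMarkov hΩ.isChain).norm_proj_initial f n
  rw [huniv, L.proj_univ] at h
  rw [h, Finset.sum_range, Finset.sum_range]
  congr 1
  · refine Finset.sum_congr rfl fun j _ => ?_
    rw [norm_restrict_sq hL.1, extendIndex_of_le S j.2]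
  · refine Finset.sum_congr rfl fun j _ => ?_
    rw [norm_restrict_sq hL.1, extendIndex_of_le S (show (j : ℕ) < n + 1 by omega),
      extendIndex_of_le S (show (j : ℕ) + 1 < n + 1 by omega)]
    rfl

end PartialKernel

end KernelCompletion
end

open KernelCompletion in
theorem mainTheorem3 {X : Type*} {n : ℕ} (Ω : Set (X × X)) (S : Fin (n + 1) → Set X)
    (hΩ : IsSerrated Ω S) (K : PartialKernel Ω) :
    (∃! L : ReproducingKernel X, K.IsCanonicalCompletion L) ∧
    ∀ L : ReproducingKernel X, K.IsCanonicalCompletion L →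
      (∀ (i j : Fin (n + 1)) (hij : i < j) (x : S i) (y : S j),
        L x y = inner ℝ
          (K.linkProd S hΩ.isClique i (le_of_lt hij) j.2 ((K.sub (S i) (hΩ.isClique i)).gen x))
          ((K.sub (S j) (hΩ.isClique j)).gen y)) ∧
      (∀ f : L.H,
        ‖f‖ ^ 2 = ∑ j : Fin (n + 1), ‖K.restrict L (S j) (hΩ.isClique j) f‖ ^ 2
          - ∑ j : Fin n, ‖K.restrict L (S j.castSucc ∩ S j.succ)
              ((hΩ.isClique j.castSucc).mono Set.inter_subset_left) f‖ ^ 2) := by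
  obtain ⟨L, hL⟩ := PartialKernel.exists_canonicalCompletion hΩ K
  exact ⟨⟨L, hL, fun L' hL' => hL'.unique hL hΩ⟩, fun L hL =>
    ⟨fun i j hij x y => hL.apply_eq hΩ hij.le x y, fun f => hL.norm_sq hΩ f⟩⟩
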